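/- Let $M>0$ and $\alpha\in(0,1]$, and let $\mathbb{D}=\{z\in\mathbb{C}:|z|<1\}$. Let $\mathcal{P}_{\mathcal{H}}^0(\alpha,M)$ be the class of functions $f=h+\overline{g}$ in $\mathbb{D}$, where $h$ and $g$ are analytic in $\mathbb{D}$ with $h(0)=g(0)=g'(0)=0$, $h'(0)=1$ and $$\operatorname{Re}\bigl((1-\alpha)h'(z)+\alpha z h''(z)\bigr)>-M+\bigl|(1-\alpha)g'(z)+\alpha z g''(z)\bigr|\qquad(z\in\mathbb{D}).$$ For $0<\rho<1$, call $f$ starlike (respectively convex) in $|z|\le\rho$ if $f$ is univalent (injective) in $|z|\le\rho$ and, for every $0<r\le\rho$, the images under $f$ of the disks $|z|<r$ and $|z|\le r$ are starlike with respect to the origin (respectively convex). Let ${}_2F_1$ denote the Gaussian hypergeometric function. Then: (i) the equation $$\alpha r\,{}_2F_1\left(1,\frac1\alpha;1+\frac1\alpha;r\right)-\frac{\alpha}{2(M-\alpha+1)}=0$$ has a smallest root $r^*$ in $(0,1)$, and every $f\in\mathcal{P}_{\mathcal{H}}^0(\alpha,M)$ is starlike in $|z|\le r^*$; (ii) the equation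 $$\frac{r}{1-r}+(2\alpha-1)\,r\,{}_2F_1\left(1,\frac1\alpha;1+\frac1\alpha;r\right)-\frac{\alpha}{2(M-\alpha+1)}=0$$ has a smallest root $r_c$ in $(0,1)$, and every $f\in\mathcal{P}_{\mathcal{H}}^0(\alpha,M)$ is convex in $|z|\le r_c$. -/

import Mathlib

open Set Metric

noncomputable section

/-- `f = h + conj g` on the open unit disk, with `h`, `g` analytic there and normalized by
`h 0 = 0`, `h' 0 = 1`, `g 0 = 0`: the pair `(h, g)` is the canonical decomposition of the
normalized harmonic function `f`. -/
structure IsNormalizedHarmonic (f h g : ℂ → ℂ) : Prop where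
  analytic_h : DifferentiableOn ℂ h (ball 0 1)
  analytic_g : DifferentiableOn ℂ g (ball 0 1)
  h_zero : h 0 = 0
  g_zero : g 0 = 0
  deriv_h_zero : deriv h 0 = 1
  eq_add_conj : ∀ z ∈ ball (0 : ℂ) 1, f z = h z + (starRingEnd ℂ) (g z)

/-- The class of normalized harmonic functions `f = h + conj g` in the open unit disk with
`g' 0 = 0` and
`Re ((1 - α) h' z + α z h'' z) > -M + |(1 - α) g' z + α z g'' z|` for `|z| < 1`.
Only the values of `f` in the open unit disk matter. -/
def PHZero (α M : ℝ) : Set (ℂ → ℂ) :=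
  {f | ∃ h g : ℂ → ℂ, IsNormalizedHarmonic f h g ∧ deriv g 0 = 0 ∧
    ∀ z ∈ ball (0 : ℂ) 1,
      -M + ‖(1 - (α : ℂ)) * deriv g z + (α : ℂ) * z * deriv (deriv g) z‖ <
        ((1 - (α : ℂ)) * deriv h z + (α : ℂ) * z * deriv (deriv h) z).re}

/-- `f` is starlike in `|z| ≤ ρ`: it is univalent there, and it maps every disk `|z| < r` and
`|z| ≤ r` with `0 < r ≤ ρ` onto a set that is starlike with respect to the origin. -/
def IsStarlikeInDisk (f : ℂ → ℂ) (ρ : ℝ) : Prop :=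
  InjOn f (closedBall 0 ρ) ∧
    ∀ r : ℝ, 0 < r → r ≤ ρ →
      StarConvex ℝ 0 (f '' ball 0 r) ∧ StarConvex ℝ 0 (f '' closedBall 0 r)

/-- `f` is convex in `|z| ≤ ρ`: it is univalent there, and it maps every disk `|z| < r` and
`|z| ≤ r` with `0 < r ≤ ρ` onto a convex set. -/
def IsConvexInDisk (f : ℂ → ℂ) (ρ : ℝ) : Prop :=
  InjOn f (closedBall 0 ρ) ∧
    ∀ r : ℝ, 0 < r → r ≤ ρ →
      Convex ℝ (f '' ball 0 r) ∧ Convex ℝ (f '' closedBall 0 r)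

/-- The function whose smallest zero in `(0, 1)` is the radius of starlikeness. -/
def starlikeFun (α M r : ℝ) : ℝ :=
  α * r * ₂F₁ (1 : ℝ) (1 / α) (1 + 1 / α) r - α / (2 * (M - α + 1))

/-- The function whose smallest zero in `(0, 1)` is the radius of convexity. -/
def convexFun (α M r : ℝ) : ℝ :=
  r / (1 - r) + (2 * α - 1) * r * ₂F₁ (1 : ℝ) (1 / α) (1 + 1 / α) r - α / (2 * (M - α + 1))

end

/-! For every unimodular `ε`, the defining inequality makes `M + (1 - α) H' + α z H''`, with `H = h
+ ε g`, a function of nonnegative real part. Carathéodory's lemma, with `ε` chosen to align the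
coefficients, gives `|aₙ| + |bₙ| ≤ 2 (M - α + 1) / (n (1 + α (n - 2)))`
(`norm_coeff_add_norm_coeff_le`). Both root equations then say that a series equals `1`: these
bounds times `n r ^ (n - 1)` for starlikeness, times `n ^ 2 r ^ (n - 1)` for convexity.

The geometry needs no derivative criterion. To reach `W = (1 - t) f z + t f w` inside a disk, solve
`e = W - (f e - e)`; the right side is a contraction in `e` as long as the series is below `1`.
Projecting onto the disk gives a fixed point, and estimates of `e ^ n` against convex combinations
of powers show that the projection did nothing (`IsMajorizedBy.convexComb_mem_image`). Starlikeness
is the case `z = 0`, where the factor `n` suffices; general `z` and `w` cost `n ^ 2`. -/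

/-! ### Circle averages and Carathéodory's lemma. -/

/-- The average of `z ^ (-n) F` over a circle about `0` is the `n`-th Taylor coefficient. -/
lemma circleAverage_inv_pow_mul {F : ℂ → ℂ} {r : ℝ} (hr : 0 < r)
    (hF : DifferentiableOn ℂ F (closedBall 0 r)) (n : ℕ) :
    Real.circleAverage (fun z => (z ^ n)⁻¹ * F z) 0 r = iteratedDeriv n F 0 / n.factorial := by
  have h := hF.circleIntegral_one_div_sub_center_pow_smul hr n
  rw [Real.circleAverage_eq_circleIntegral hr.ne']
  have h2 : (∮ z in C(0, r), (z - 0)⁻¹ • ((z ^ n)⁻¹ * F z)) =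
      ∮ z in C(0, r), (1 / (z - 0) ^ (n + 1)) • F z := by
    congr 1
    ext z
    simp only [sub_zero, smul_eq_mul, pow_succ, one_div, mul_inv]
    ring
  rw [h2, h, smul_smul, smul_eq_mul]
  have : (2 * (Real.pi : ℂ) * Complex.I) ≠ 0 := by
    simp [Real.pi_ne_zero]
  field_simp

lemma norm_circleAverage_le {f : ℂ → ℂ} {c : ℂ} {r : ℝ} :
    ‖Real.circleAverage f c r‖ ≤ Real.circleAverage (fun z => ‖f z‖) c r := by
  rw [Real.circleAverage, Real.circleAverage, norm_smul, smul_eq_mul, Real.norm_eq_abs,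
    abs_of_pos (inv_pos.2 Real.two_pi_pos)]
  gcongr
  exact intervalIntegral.norm_integral_le_integral_norm Real.two_pi_pos.le

/-- Carathéodory's coefficient bound on a disk of radius `r`, for `F` analytic on its closure. -/
lemma norm_iteratedDeriv_mul_pow_le {F : ℂ → ℂ} {r : ℝ} (hr : 0 < r)
    (hF : DifferentiableOn ℂ F (closedBall 0 r))
    (hre : ∀ z ∈ closedBall (0 : ℂ) r, 0 ≤ (F z).re) {n : ℕ} (hn : n ≠ 0) :
    ‖iteratedDeriv n F 0‖ / n.factorial * r ^ n ≤ 2 * (F 0).re := by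
  have hsph : ∀ z ∈ sphere (0 : ℂ) r, z ≠ 0 ∧ ‖z‖ = r := by
    intro z hz
    have : ‖z‖ = r := by simpa using hz
    exact ⟨norm_pos_iff.1 (this ▸ hr), this⟩
  have hFc : ContinuousOn F (sphere 0 r) := hF.continuousOn.mono sphere_subset_closedBall
  have hci {f : ℂ → ℂ} (hf : ContinuousOn f (sphere 0 r)) : CircleIntegrable f 0 r :=
    hf.circleIntegrable hr.le
  have hinv : ContinuousOn (fun z : ℂ => (z ^ n)⁻¹) (sphere 0 r) :=
    (continuousOn_id.pow n).inv₀ fun z hz => pow_ne_zero n (hsph z hz).1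
  have h1 := circleAverage_inv_pow_mul hr hF n
  have h2 : Real.circleAverage (fun z => z ^ n * F z) 0 r = 0 := by
    have hd : DifferentiableOn ℂ (fun z => z ^ n * F z) (closedBall 0 r) := by fun_prop
    have := circleAverage_inv_pow_mul hr hd 0
    simpa [hn] using this
  -- On the circle `z⁻¹ = conj z / r ^ 2`, so this average is a multiple of the conjugate of the
  -- vanishing one in `h2`.
  have h3 : Real.circleAverage (fun z => (z ^ n)⁻¹ * (starRingEnd ℂ) (F z)) 0 r = 0 := by
    have hc := (Complex.conjCLE : ℂ →L[ℝ] ℂ).circleAverage_comp_comm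
      (f := fun z => z ^ n * F z) (hci (by fun_prop))
    have hs : Real.circleAverage (fun z => (z ^ n)⁻¹ * (starRingEnd ℂ) (F z)) 0 r =
        Real.circleAverage (fun z => ((((r ^ 2) ^ n)⁻¹ : ℝ) : ℂ) •
          ((Complex.conjCLE : ℂ →L[ℝ] ℂ) ∘ fun z => z ^ n * F z) z) 0 r := by
      apply Real.circleAverage_congr_sphere
      intro z hz
      rw [abs_of_pos hr] at hz
      obtain ⟨hz0, hzn⟩ := hsph z hz
      have hzz : z * (starRingEnd ℂ) z = ((r ^ 2 : ℝ) : ℂ) := by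
        rw [Complex.mul_conj, Complex.normSq_eq_norm_sq, hzn]
      have hr0 : (((r ^ 2) : ℝ) : ℂ) ≠ 0 := by
        exact_mod_cast (pow_pos hr 2).ne'
      simp only [Function.comp_apply, ContinuousLinearEquiv.coe_coe, Complex.conjCLE_apply, map_mul,
        map_pow, smul_eq_mul, Complex.ofReal_inv]
      rw [Complex.ofReal_pow, ← hzz, mul_pow, ← mul_assoc]
      congr 1
      have : (starRingEnd ℂ) z ≠ 0 := by simpa using hz0
      field_simp
    rw [hs, Real.circleAverage_fun_smul, hc, h2]
    simp
  -- Adding the zero average `h3` replaces `F` by `2 Re F`, whose modulus is itself; the mean value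
  -- property `h5` then evaluates the bound.
  have h4 : iteratedDeriv n F 0 / n.factorial =
      Real.circleAverage (fun z => (z ^ n)⁻¹ * ((2 * (F z).re : ℝ) : ℂ)) 0 r := by
    have hadd := Real.circleAverage_fun_add (f₁ := fun z => (z ^ n)⁻¹ * F z)
      (f₂ := fun z => (z ^ n)⁻¹ * (starRingEnd ℂ) (F z)) (hci (hinv.mul hFc))
      (hci (hinv.mul (Complex.continuous_conj.comp_continuousOn hFc)))
    rw [h3, add_zero, h1] at hadd
    rw [← hadd]
    congr 1
    ext z
    rw [← mul_add, Complex.add_conj]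
  have h5 : Real.circleAverage (fun z => (F z).re) 0 r = (F 0).re := by
    have hc := Complex.reCLM.circleAverage_comp_comm (hci hFc)
    have hm := circleAverage_inv_pow_mul hr hF 0
    simp only [pow_zero, inv_one, one_mul, iteratedDeriv_zero, Nat.factorial_zero, Nat.cast_one,
      div_one] at hm
    rw [show Real.circleAverage F 0 r = F 0 from hm] at hc
    exact hc
  have h6 : ‖iteratedDeriv n F 0‖ / n.factorial ≤ (r ^ n)⁻¹ * 2 * (F 0).re := by
    rw [← h5, ← smul_eq_mul, ← Real.circleAverage_fun_smul]
    have : ‖iteratedDeriv n F 0‖ / n.factorial = ‖iteratedDeriv n F 0 / n.factorial‖ := by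
      simp
    rw [this, h4]
    refine norm_circleAverage_le.trans_eq (Real.circleAverage_congr_sphere fun z hz => ?_)
    rw [abs_of_pos hr] at hz
    have hp := hre z (sphere_subset_closedBall hz)
    simp only [norm_mul, norm_inv, norm_pow, (hsph z hz).2, Complex.norm_real, Real.norm_eq_abs,
      smul_eq_mul, abs_of_nonneg hp, abs_two]
    ring
  calc _ ≤ (r ^ n)⁻¹ * 2 * (F 0).re * r ^ n := by gcongr
    _ = _ := by field_simp

/-- **Carathéodory's lemma**: the Taylor coefficients of an analytic function with nonnegative
real part on the unit disk. -/
lemma norm_iteratedDeriv_div_factorial_le {F : ℂ → ℂ} (hF : DifferentiableOn ℂ F (ball 0 1))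
    (hre : ∀ z ∈ ball (0 : ℂ) 1, 0 ≤ (F z).re) {n : ℕ} (hn : n ≠ 0) :
    ‖iteratedDeriv n F 0‖ / n.factorial ≤ 2 * (F 0).re := by
  have hlim : Filter.Tendsto (fun r : ℝ => ‖iteratedDeriv n F 0‖ / n.factorial * r ^ n)
      (nhdsWithin 1 (Iio 1)) (nhds (‖iteratedDeriv n F 0‖ / n.factorial * 1 ^ n)) :=
    (Continuous.tendsto (by fun_prop) 1).mono_left nhdsWithin_le_nhds
  rw [one_pow, mul_one] at hlim
  refine le_of_tendsto hlim ?_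
  filter_upwards [Ioo_mem_nhdsLT (zero_lt_one' ℝ)] with r hr
  have hsub : closedBall (0 : ℂ) r ⊆ ball 0 1 := closedBall_subset_ball hr.2
  exact norm_iteratedDeriv_mul_pow_le hr.1 (hF.mono hsub) (fun z hz => hre z (hsub hz)) hn

/-! ### Coefficient bounds for the class. -/

/-- Taylor coefficients of `(a h' + b z h'')` at the origin. -/
lemma iteratedDeriv_deriv_add_mul_deriv {H : ℂ → ℂ} (hH : AnalyticAt ℂ H 0) (a b : ℂ) (n : ℕ) :
    iteratedDeriv n (fun z => a * deriv H z + b * z * deriv (deriv H) z) 0 =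
      (a + b * n) * iteratedDeriv (n + 1) H 0 := by
  have c1 : ContDiffAt ℂ n (deriv H) 0 := hH.deriv.contDiffAt
  have c2 : ContDiffAt ℂ n (deriv (deriv H)) 0 := hH.deriv.deriv.contDiffAt
  have cid : ContDiffAt ℂ n (fun z : ℂ => z) 0 := contDiffAt_id
  have e : (fun z => a * deriv H z + b * z * deriv (deriv H) z) =
      fun z => a * deriv H z + b * (z * deriv (deriv H) z) := by
    ext z; ring
  rw [e, iteratedDeriv_fun_add (contDiffAt_const.mul c1) (contDiffAt_const.mul (cid.mul c2)),
    iteratedDeriv_const_mul_field, iteratedDeriv_const_mul_field, iteratedDeriv_succ',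
    iteratedDeriv_fun_mul cid c2]
  simp only [iteratedDeriv_fun_id_zero]
  have : ∑ i ∈ Finset.range (n + 1), (n.choose i : ℂ) * (if i = 1 then 1 else 0) *
      iteratedDeriv (n - i) (deriv (deriv H)) 0 = n * iteratedDeriv n (deriv H) 0 := by
    rcases n with _ | n
    · simp
    · rw [Finset.sum_eq_single 1]
      · simp [iteratedDeriv_succ']
      · intro i _ hi
        simp [hi]
      · simp
  rw [this]
  ring

/-- Rotating `b` onto the direction of `a` turns a sum of two moduli into the modulus of one
coefficient of `h + ε g`. -/
lemma exists_norm_eq_one_norm_add_mul (a b : ℂ) :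
    ∃ ε : ℂ, ‖ε‖ = 1 ∧ ‖a + ε * b‖ = ‖a‖ + ‖b‖ := by
  by_cases ha : a = 0
  · exact ⟨1, by simp, by simp [ha]⟩
  by_cases hb : b = 0
  · exact ⟨1, by simp, by simp [hb]⟩
  have ha' : (‖a‖ : ℂ) ≠ 0 := by simpa using ha
  have hb' : (‖b‖ : ℂ) ≠ 0 := by simpa using hb
  refine ⟨a * ‖b‖ / (‖a‖ * b), ?_, ?_⟩
  · have h1 : ‖a‖ ≠ 0 := norm_ne_zero_iff.2 ha
    have h2 : ‖b‖ ≠ 0 := norm_ne_zero_iff.2 hb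
    simp only [norm_div, norm_mul, Complex.norm_real, norm_norm]
    field_simp
  · have : a + a * ‖b‖ / (‖a‖ * b) * b = a * ((1 + ‖b‖ / ‖a‖ : ℝ) : ℂ) := by
      push_cast
      field_simp
    rw [this, norm_mul, Complex.norm_real, Real.norm_eq_abs, abs_of_nonneg (by positivity)]
    have h1 : ‖a‖ ≠ 0 := norm_ne_zero_iff.2 ha
    field_simp

/-- The sharp bound on the sum of the moduli of the coefficients of index `m + 2` in `PHZero`. -/
noncomputable def coeffBound (α M : ℝ) (m : ℕ) : ℝ := 2 * (M - α + 1) / ((m + 2) * (1 + α * m))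

lemma coeffBound_pos {α M : ℝ} (hα : 0 < α) (hα' : α ≤ 1) (hM : 0 < M) (m : ℕ) :
    0 < coeffBound α M m := by
  have : 0 < M - α + 1 := by linarith
  unfold coeffBound
  positivity

lemma norm_coeff_add_norm_coeff_le {α M : ℝ} (hα : 0 < α) {f h g : ℂ → ℂ}
    (hf : IsNormalizedHarmonic f h g) (hg : deriv g 0 = 0)
    (hbd : ∀ z ∈ ball (0 : ℂ) 1,
      -M + ‖(1 - (α : ℂ)) * deriv g z + (α : ℂ) * z * deriv (deriv g) z‖ <
        ((1 - (α : ℂ)) * deriv h z + (α : ℂ) * z * deriv (deriv h) z).re) (m : ℕ) :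
    ‖iteratedDeriv (m + 2) h 0 / (m + 2).factorial‖ +
      ‖iteratedDeriv (m + 2) g 0 / (m + 2).factorial‖ ≤ coeffBound α M m := by
  have hfac : (0 : ℝ) < (m + 2).factorial := by exact_mod_cast (m + 2).factorial_pos
  obtain ⟨ε, hε, hab⟩ := exists_norm_eq_one_norm_add_mul (iteratedDeriv (m + 2) h 0)
    (iteratedDeriv (m + 2) g 0)
  have h0 : (0 : ℂ) ∈ ball (0 : ℂ) 1 := by simp
  set H : ℂ → ℂ := fun z => h z + ε * g z with hH
  have dH : DifferentiableOn ℂ H (ball 0 1) := hf.analytic_h.add (hf.analytic_g.const_mul ε)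
  have d1 : ∀ z ∈ ball (0 : ℂ) 1, deriv H z = deriv h z + ε * deriv g z := fun z hz => by
    have e1 := (hf.analytic_h.differentiableAt (isOpen_ball.mem_nhds hz))
    have e2 := (hf.analytic_g.differentiableAt (isOpen_ball.mem_nhds hz))
    exact (e1.hasDerivAt.add (e2.hasDerivAt.const_mul ε)).deriv
  have d2 : ∀ z ∈ ball (0 : ℂ) 1,
      deriv (deriv H) z = deriv (deriv h) z + ε * deriv (deriv g) z := fun z hz => by
    have e1 := (hf.analytic_h.deriv isOpen_ball).differentiableAt (isOpen_ball.mem_nhds hz)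
    have e2 := (hf.analytic_g.deriv isOpen_ball).differentiableAt (isOpen_ball.mem_nhds hz)
    rw [Filter.EventuallyEq.deriv_eq (Filter.eventually_of_mem (isOpen_ball.mem_nhds hz) d1)]
    exact (e1.hasDerivAt.add (e2.hasDerivAt.const_mul ε)).deriv
  set G : ℂ → ℂ := fun z =>
    (1 - (α : ℂ)) * deriv H z + (α : ℂ) * z * deriv (deriv H) z with hG
  have dG : DifferentiableOn ℂ G (ball 0 1) := by
    have e1 := dH.deriv isOpen_ball
    have e2 := e1.deriv isOpen_ball
    simp only [hG]
    fun_prop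
  have hpos : ∀ z ∈ ball (0 : ℂ) 1, 0 ≤ ((fun z => (M : ℂ) + G z) z).re := fun z hz => by
    have hz' := hbd z hz
    set A := (1 - (α : ℂ)) * deriv h z + (α : ℂ) * z * deriv (deriv h) z
    set B := (1 - (α : ℂ)) * deriv g z + (α : ℂ) * z * deriv (deriv g) z
    have e : G z = A + ε * B := by
      simp only [hG, d1 z hz, d2 z hz, A, B]
      ring
    have hB : -‖B‖ ≤ (ε * B).re := by
      have := (abs_le.1 (Complex.abs_re_le_norm (ε * B))).1
      rwa [norm_mul, hε, one_mul] at this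
    simp only [e, Complex.add_re, Complex.ofReal_re]
    linarith
  have hC := norm_iteratedDeriv_div_factorial_le (n := m + 1)
    ((differentiableOn_const (M : ℂ)).add dG) hpos (by simp)
  have hder : iteratedDeriv (m + 1) ((fun _ => (M : ℂ)) + G) 0 =
      (1 + α * m) * iteratedDeriv (m + 2) H 0 := by
    have : iteratedDeriv (m + 1) ((fun _ => (M : ℂ)) + G) 0 = iteratedDeriv (m + 1) G 0 := by
      rw [iteratedDeriv_add contDiffAt_const
        (dG.analyticAt (isOpen_ball.mem_nhds h0)).contDiffAt, iteratedDeriv_const]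
      simp
    rw [this, hG, iteratedDeriv_deriv_add_mul_deriv (dH.analyticAt (isOpen_ball.mem_nhds h0))]
    push_cast
    ring
  have hHc : iteratedDeriv (m + 2) H 0 =
      iteratedDeriv (m + 2) h 0 + ε * iteratedDeriv (m + 2) g 0 := by
    have c1 := (hf.analytic_h.analyticAt (isOpen_ball.mem_nhds h0)).contDiffAt (n := (m + 2 : ℕ))
    have c2 := (hf.analytic_g.analyticAt (isOpen_ball.mem_nhds h0)).contDiffAt (n := (m + 2 : ℕ))
    rw [hH, iteratedDeriv_fun_add c1 (contDiffAt_const.mul c2), iteratedDeriv_const_mul_field]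
  -- The value at the origin, which is the constant in Carathéodory's bound; `g' 0 = 0` removes `ε`
  -- from it.
  have hG0 : (((fun _ => (M : ℂ)) + G : ℂ → ℂ) 0).re = M - α + 1 := by
    simp only [Pi.add_apply, hG, d1 0 h0, hf.deriv_h_zero, hg]
    simp
    ring
  have hnn : 0 < 1 + α * m := by positivity
  have hn1 : ‖(1 + α * m : ℂ)‖ = 1 + α * m := by
    have : (1 + α * m : ℂ) = ((1 + α * m : ℝ) : ℂ) := by push_cast; ring
    rw [this, Complex.norm_real, Real.norm_eq_abs, abs_of_pos hnn]
  rw [hder, hG0, norm_mul, hn1, hHc, hab, div_le_iff₀ (by positivity)] at hC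
  rw [norm_div, norm_div, Complex.norm_natCast, ← add_div, coeffBound, div_le_div_iff₀ hfac
    (by positivity)]
  have : ((m + 2).factorial : ℝ) = (m + 2) * (m + 1).factorial := by
    rw [Nat.factorial_succ]; push_cast; ring
  rw [this]
  have h2 : (0 : ℝ) ≤ m + 2 := by positivity
  nlinarith [mul_le_mul_of_nonneg_left hC h2]

/-! ### Termwise majorization of `f - id`. -/

/-- `f - id` is controlled termwise by the power series with coefficients `C`. -/
def IsMajorizedBy (f : ℂ → ℂ) (C : ℕ → ℝ) : Prop :=
  ∀ e ∈ ball (0 : ℂ) 1, ∀ z ∈ ball (0 : ℂ) 1, ∀ w ∈ ball (0 : ℂ) 1, ∀ t : ℝ, ∀ (D : ℕ → ℝ) (S : ℝ),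
    (∀ m, C m * ‖e ^ (m + 2) - ((1 - t) * z ^ (m + 2) + t * w ^ (m + 2))‖ ≤ D m) → HasSum D S →
    ‖(f e - e) - ((1 - t) * (f z - z) + t * (f w - w))‖ ≤ S

lemma IsNormalizedHarmonic.hasSum_sub_id {f h g : ℂ → ℂ} (hf : IsNormalizedHarmonic f h g)
    (hg : deriv g 0 = 0) {z : ℂ} (hz : z ∈ ball (0 : ℂ) 1) :
    HasSum (fun m : ℕ => iteratedDeriv (m + 2) h 0 / (m + 2).factorial * z ^ (m + 2) +
      (starRingEnd ℂ) (iteratedDeriv (m + 2) g 0 / (m + 2).factorial * z ^ (m + 2))) (f z - z) := by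
  have key : ∀ {k : ℂ → ℂ}, DifferentiableOn ℂ k (ball 0 1) → k 0 = 0 →
      HasSum (fun m : ℕ => iteratedDeriv (m + 2) k 0 / (m + 2).factorial * z ^ (m + 2))
        (k z - deriv k 0 * z) := by
    intro k hk hk0
    have h1 := (hasSum_nat_add_iff' 2).2 (Complex.hasSum_taylorSeries_on_ball hk hz)
    simp only [Finset.sum_range_succ, Finset.sum_range_zero, iteratedDeriv_zero, iteratedDeriv_one,
      hk0, smul_eq_mul, sub_zero] at h1
    convert! h1 using 1
    · ext m
      field_simp
    · simp [mul_comm]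
  have e1 := key hf.analytic_h hf.h_zero
  have e2 := key hf.analytic_g hf.g_zero
  rw [hf.deriv_h_zero, one_mul] at e1
  rw [hg, zero_mul, sub_zero] at e2
  have e3 := e1.add (e2.map (starRingEnd ℂ) Complex.continuous_conj)
  rw [hf.eq_add_conj z hz]
  convert! e3 using 1
  ring

/-- Conjugation commutes with the real weights `1 - t` and `t`, so the analytic and antianalytic
parts of each term share one factor `Q`, and only `|aₙ| + |bₙ|` enters. -/
lemma isMajorizedBy_of_mem_PHZero {α M : ℝ} (hα : 0 < α) {f : ℂ → ℂ} (hf : f ∈ PHZero α M) :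
    IsMajorizedBy f (coeffBound α M) := by
  obtain ⟨h, g, hn, hg, hbd⟩ := hf
  intro e he z hz w hw t D S hD hS
  have h1 := (hn.hasSum_sub_id hg he).sub (((hn.hasSum_sub_id hg hz).mul_left (1 - t : ℂ)).add
    ((hn.hasSum_sub_id hg hw).mul_left (t : ℂ)))
  rw [← h1.tsum_eq]
  refine tsum_of_norm_bounded hS fun m => le_trans ?_ (hD m)
  refine le_trans ?_ (mul_le_mul_of_nonneg_right
    (norm_coeff_add_norm_coeff_le hα hn hg hbd m) (norm_nonneg _))
  set a := iteratedDeriv (m + 2) h 0 / (m + 2).factorial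
  set b := iteratedDeriv (m + 2) g 0 / (m + 2).factorial
  set Q := e ^ (m + 2) - ((1 - t) * z ^ (m + 2) + t * w ^ (m + 2)) with hQ
  have hsplit : (a * e ^ (m + 2) + (starRingEnd ℂ) (b * e ^ (m + 2)) -
      ((1 - t) * (a * z ^ (m + 2) + (starRingEnd ℂ) (b * z ^ (m + 2))) +
        t * (a * w ^ (m + 2) + (starRingEnd ℂ) (b * w ^ (m + 2))))) =
      a * Q + (starRingEnd ℂ) (b * Q) := by
    simp only [hQ, map_mul, map_sub, map_add, map_one, Complex.conj_ofReal]
    ring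
  rw [hsplit, add_mul]
  refine (norm_add_le _ _).trans_eq ?_
  rw [RCLike.norm_conj, norm_mul, norm_mul]

lemma continuousOn_of_mem_PHZero {α M : ℝ} {f : ℂ → ℂ} (hf : f ∈ PHZero α M) :
    ContinuousOn f (ball 0 1) := by
  obtain ⟨h, g, hn, -, -⟩ := hf
  exact (hn.analytic_h.continuousOn.add
    (Complex.continuous_conj.comp_continuousOn hn.analytic_g.continuousOn)).congr hn.eq_add_conj

lemma map_zero_of_mem_PHZero {α M : ℝ} {f : ℂ → ℂ} (hf : f ∈ PHZero α M) : f 0 = 0 := by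
  obtain ⟨h, g, hn, -, -⟩ := hf
  rw [hn.eq_add_conj 0 (by simp), hn.h_zero, hn.g_zero]
  simp

/-! ### Powers against convex combinations of powers. -/

lemma norm_pow_succ_sub_pow_succ_le {x y : ℂ} {s : ℝ} (hx : ‖x‖ ≤ s) (hy : ‖y‖ ≤ s) (m : ℕ) :
    ‖x ^ (m + 1) - y ^ (m + 1)‖ ≤ (m + 1) * s ^ m * ‖x - y‖ := by
  have hs : 0 ≤ s := (norm_nonneg x).trans hx
  induction m with
  | zero => simp
  | succ m ih =>
    have e : x ^ (m + 1 + 1) - y ^ (m + 1 + 1) =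
        x * (x ^ (m + 1) - y ^ (m + 1)) + y ^ (m + 1) * (x - y) := by ring
    have h1 : ‖x * (x ^ (m + 1) - y ^ (m + 1))‖ ≤ s * ((m + 1) * s ^ m * ‖x - y‖) := by
      rw [norm_mul]; gcongr
    have h2 : ‖y ^ (m + 1) * (x - y)‖ ≤ s ^ (m + 1) * ‖x - y‖ := by
      rw [norm_mul, norm_pow]; gcongr
    rw [e]
    refine (norm_add_le _ _).trans ((add_le_add h1 h2).trans_eq ?_)
    push_cast
    ring

/-- The difference of the squares is `(1 - t) (1 + t - 2 t Re u) ≥ (1 - t) ^ 2`. -/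
lemma mul_norm_one_sub_le {u : ℂ} (hu : ‖u‖ ≤ 1) {t : ℝ} (h0 : 0 ≤ t) (h1 : t ≤ 1) :
    t * ‖1 - u‖ ≤ ‖1 - t * u‖ := by
  have hre : u.re ≤ 1 := (Complex.re_le_norm u).trans hu
  rw [← sq_le_sq₀ (by positivity) (norm_nonneg _), mul_pow, ← Complex.normSq_eq_norm_sq,
    ← Complex.normSq_eq_norm_sq, Complex.normSq_apply, Complex.normSq_apply]
  simp only [Complex.sub_re, Complex.one_re, Complex.sub_im, Complex.one_im, Complex.mul_re,
    Complex.ofReal_re, Complex.ofReal_im, Complex.mul_im, zero_mul, sub_zero, add_zero, zero_sub]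
  nlinarith [mul_nonneg (mul_nonneg h0 (sub_nonneg.2 h1)) (sub_nonneg.2 hre), sq_nonneg (1 - t)]

lemma norm_one_sub_mul_pow_le {u : ℂ} (hu : ‖u‖ ≤ 1) {t : ℝ} (h0 : 0 ≤ t) (h1 : t ≤ 1) (m : ℕ) :
    ‖1 - t * u ^ (m + 1)‖ ≤ (m + 1) * ‖1 - t * u‖ := by
  rcases m with _ | m
  · simp
  have hp : ‖(1 : ℂ) - u ^ (m + 1)‖ ≤ (m + 1) * ‖1 - u‖ := by
    simpa using norm_pow_succ_sub_pow_succ_le (x := 1) (s := 1) (by simp) hu m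
  have e : 1 - t * u ^ (m + 1 + 1) = (1 - t * u) + u * (t * (1 - u ^ (m + 1))) := by ring
  have h2 : ‖u * (t * (1 - u ^ (m + 1)))‖ ≤ (m + 1) * ‖1 - t * u‖ := by
    rw [norm_mul, norm_mul, Complex.norm_real, Real.norm_eq_abs, abs_of_nonneg h0]
    calc ‖u‖ * (t * ‖1 - u ^ (m + 1)‖) ≤ 1 * (t * ((m + 1) * ‖1 - u‖)) := by gcongr
      _ = (m + 1) * (t * ‖1 - u‖) := by ring
      _ ≤ _ := by gcongr; exact mul_norm_one_sub_le hu h0 h1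
  rw [e]
  refine (norm_add_le _ _).trans ((add_le_add_right h2 _).trans_eq ?_)
  push_cast
  ring

lemma norm_one_sub_sq_le {u : ℂ} (hu : ‖u‖ ≤ 1) : ‖1 - u‖ ^ 2 ≤ 2 * (1 - u.re) := by
  have h : ‖u‖ ^ 2 ≤ 1 := pow_le_one₀ (norm_nonneg _) hu
  rw [← Complex.normSq_eq_norm_sq, Complex.normSq_apply] at h ⊢
  simp only [Complex.sub_re, Complex.one_re, Complex.sub_im, Complex.one_im]
  nlinarith

/-- The second-order remainder is measured by `1 - Re u`, which is affine in `u` and therefore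
survives averaging. -/
lemma norm_one_sub_pow_sub_mul_le {u : ℂ} (hu : ‖u‖ ≤ 1) (m : ℕ) :
    ‖1 - u ^ (m + 1) - (m + 1) * (1 - u)‖ ≤ (m + 1) * m * (1 - u.re) := by
  induction m with
  | zero => simp
  | succ m ih =>
    have e : 1 - u ^ (m + 1 + 1) - (((m + 1 : ℕ) : ℂ) + 1) * (1 - u) =
        u * (1 - u ^ (m + 1) - (m + 1) * (1 - u)) - ((m + 1 : ℝ) : ℂ) * (1 - u) ^ 2 := by
      push_cast
      ring
    have h1 : ‖u * (1 - u ^ (m + 1) - (m + 1) * (1 - u))‖ ≤ (m + 1) * m * (1 - u.re) := by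
      rw [norm_mul]
      exact (mul_le_of_le_one_left (norm_nonneg _) hu).trans ih
    have h2 : ‖((m + 1 : ℝ) : ℂ) * (1 - u) ^ 2‖ ≤ (m + 1) * (2 * (1 - u.re)) := by
      rw [norm_mul, norm_pow, Complex.norm_real, Real.norm_eq_abs, abs_of_nonneg (by positivity)]
      gcongr
      exact norm_one_sub_sq_le hu
    rw [e]
    refine (norm_sub_le _ _).trans ((add_le_add h1 h2).trans_eq ?_)
    push_cast
    ring

/-- The averaged remainders add up to `(m + 1) m Re W ≤ (m + 1) m ‖W‖`; with the linear part `(m +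
1) ‖W‖` this makes the square. -/
lemma norm_one_sub_convexComb_pow_le {u v : ℂ} (hu : ‖u‖ ≤ 1) (hv : ‖v‖ ≤ 1) {t : ℝ} (h0 : 0 ≤ t)
    (h1 : t ≤ 1) (m : ℕ) :
    ‖1 - ((1 - t) * u ^ (m + 1) + t * v ^ (m + 1))‖ ≤
      (m + 1) ^ 2 * ‖1 - ((1 - t) * u + t * v)‖ := by
  set W := 1 - ((1 - t) * u + t * v) with hW
  have h1' : 0 ≤ 1 - t := sub_nonneg.2 h1
  have e : 1 - ((1 - t) * u ^ (m + 1) + t * v ^ (m + 1)) = ((m + 1 : ℝ) : ℂ) * W +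
      (((1 - t : ℝ) : ℂ) * (1 - u ^ (m + 1) - (m + 1) * (1 - u)) +
        (t : ℂ) * (1 - v ^ (m + 1) - (m + 1) * (1 - v))) := by
    simp only [hW]
    push_cast
    ring
  have a1 : ‖((m + 1 : ℝ) : ℂ) * W‖ = (m + 1) * ‖W‖ := by
    rw [norm_mul, Complex.norm_real, Real.norm_eq_abs, abs_of_nonneg (by positivity)]
  have a2 : ‖((1 - t : ℝ) : ℂ) * (1 - u ^ (m + 1) - (m + 1) * (1 - u))‖ ≤
      (1 - t) * ((m + 1) * m * (1 - u.re)) := by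
    rw [norm_mul, Complex.norm_real, Real.norm_eq_abs, abs_of_nonneg h1']
    gcongr
    exact norm_one_sub_pow_sub_mul_le hu m
  have a3 : ‖(t : ℂ) * (1 - v ^ (m + 1) - (m + 1) * (1 - v))‖ ≤
      t * ((m + 1) * m * (1 - v.re)) := by
    rw [norm_mul, Complex.norm_real, Real.norm_eq_abs, abs_of_nonneg h0]
    gcongr
    exact norm_one_sub_pow_sub_mul_le hv m
  have hre : W.re = (1 - t) * (1 - u.re) + t * (1 - v.re) := by
    simp [hW]
    ring
  rw [e]
  calc _ ≤ (m + 1) * ‖W‖ + ((1 - t) * ((m + 1) * m * (1 - u.re)) +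
        t * ((m + 1) * m * (1 - v.re))) :=
        (norm_add_le _ _).trans (add_le_add a1.le ((norm_add_le _ _).trans (add_le_add a2 a3)))
    _ = (m + 1) * ‖W‖ + (m + 1) * m * W.re := by rw [hre]; ring
    _ ≤ (m + 1) * ‖W‖ + (m + 1) * m * ‖W‖ := by gcongr; exact Complex.re_le_norm W
    _ = _ := by ring

/-- Homogeneity: dividing by `e` reduces to the unit disk and the point `1`. -/
lemma norm_pow_sub_convexComb_pow_le_of_unit {e z w : ℂ} {s t d : ℝ} (hs : 0 < s) (he : ‖e‖ = s)
    {m : ℕ} (h : ‖1 - ((1 - t) * (z / e) ^ (m + 1) + t * (w / e) ^ (m + 1))‖ ≤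
      d * ‖1 - ((1 - t) * (z / e) + t * (w / e))‖) :
    ‖e ^ (m + 1) - ((1 - t) * z ^ (m + 1) + t * w ^ (m + 1))‖ ≤
      d * s ^ m * ‖e - ((1 - t) * z + t * w)‖ := by
  have he0 : e ≠ 0 := norm_pos_iff.1 (he ▸ hs)
  have e1 : e ^ (m + 1) - ((1 - t) * z ^ (m + 1) + t * w ^ (m + 1)) =
      e ^ (m + 1) * (1 - ((1 - t) * (z / e) ^ (m + 1) + t * (w / e) ^ (m + 1))) := by
    simp only [div_pow]
    field_simp
  have e2 : e - ((1 - t) * z + t * w) = e * (1 - ((1 - t) * (z / e) + t * (w / e))) := by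
    field_simp
  rw [e1, e2, norm_mul, norm_mul, norm_pow, he]
  calc _ ≤ s ^ (m + 1) * (d * ‖1 - ((1 - t) * (z / e) + t * (w / e))‖) := by gcongr
    _ = _ := by ring

lemma norm_pow_sub_mul_pow_le {e w : ℂ} {s t : ℝ} (hs : 0 < s) (he : ‖e‖ = s) (hw : ‖w‖ ≤ s)
    (h0 : 0 ≤ t) (h1 : t ≤ 1) (m : ℕ) :
    ‖e ^ (m + 1) - ((1 - t) * 0 ^ (m + 1) + t * w ^ (m + 1))‖ ≤
      (m + 1) * s ^ m * ‖e - ((1 - t) * 0 + t * w)‖ := by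
  have hu : ‖w / e‖ ≤ 1 := by rw [norm_div, he]; exact div_le_one_of_le₀ hw hs.le
  refine norm_pow_sub_convexComb_pow_le_of_unit hs he ?_
  simpa using norm_one_sub_mul_pow_le hu h0 h1 m

lemma norm_pow_sub_convexComb_pow_le {e z w : ℂ} {s t : ℝ} (hs : 0 < s) (he : ‖e‖ = s)
    (hz : ‖z‖ ≤ s) (hw : ‖w‖ ≤ s) (h0 : 0 ≤ t) (h1 : t ≤ 1) (m : ℕ) :
    ‖e ^ (m + 1) - ((1 - t) * z ^ (m + 1) + t * w ^ (m + 1))‖ ≤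
      (m + 1) ^ 2 * s ^ m * ‖e - ((1 - t) * z + t * w)‖ := by
  have hu : ‖z / e‖ ≤ 1 := by rw [norm_div, he]; exact div_le_one_of_le₀ hz hs.le
  have hv : ‖w / e‖ ≤ 1 := by rw [norm_div, he]; exact div_le_one_of_le₀ hw hs.le
  exact norm_pow_sub_convexComb_pow_le_of_unit hs he (norm_one_sub_convexComb_pow_le hu hv h0 h1 m)

/-! ### Attaining convex combinations by a projected contraction; univalence. -/

/-- The nearest-point retraction onto a closed disk about the origin. -/
lemma exists_retraction_closedBall {s : ℝ} (hs : 0 < s) :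
    ∃ P : ℂ → ℂ, (∀ x, ‖P x‖ ≤ s) ∧ (∀ x, ‖x‖ ≤ s → P x = x) ∧ (∀ x, P x = x ∨ ‖P x‖ = s) ∧
      ∀ x y, ‖P x - P y‖ ≤ ‖x - y‖ := by
  let c : ℂ → ℝ := fun x => max s ‖x‖ / s
  have hc1 : ∀ x, 1 ≤ c x := fun x => (one_le_div hs).2 (le_max_left _ _)
  have hc0 : ∀ x, 0 < c x := fun x => zero_lt_one.trans_le (hc1 x)
  let P : ℂ → ℂ := fun x => (c x)⁻¹ • x
  have hxP : ∀ x, x = c x • P x := fun x => by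
    simp only [P]
    rw [smul_inv_smul₀ (hc0 x).ne']
  have hnorm : ∀ x, ‖P x‖ ≤ s := fun x => by
    simp only [P]
    rw [norm_smul, Real.norm_eq_abs, abs_of_pos (inv_pos.2 (hc0 x)), inv_mul_le_iff₀ (hc0 x)]
    simp only [c]
    rw [div_mul_cancel₀ _ hs.ne']
    exact le_max_right _ _
  have hin : ∀ x, ‖x‖ ≤ s → c x = 1 := fun x hx => by
    simp only [c, max_eq_left hx, div_self hs.ne']
  have hdich : ∀ x, c x = 1 ∨ ‖P x‖ = s := fun x => by
    rcases le_total ‖x‖ s with hx | hx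
    · exact Or.inl (hin x hx)
    · right
      have : ‖x‖ ≠ 0 := (hs.trans_le hx).ne'
      simp only [P, c, max_eq_right hx]
      rw [norm_smul, Real.norm_eq_abs, abs_of_pos (by positivity)]
      field_simp
  -- `x - P x` is an outward normal at `P x`. Adding the inequalities for `(x, y)` and `(y, x)` and
  -- using Cauchy–Schwarz makes `P` nonexpansive.
  have hvar : ∀ x y, 0 ≤ inner ℝ (x - P x) (P x - P y) := fun x y => by
    have hx : x - P x = (c x - 1) • P x := by
      rw [sub_smul, one_smul, ← hxP]
    rw [hx, real_inner_smul_left]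
    rcases hdich x with h | h
    · simp [h]
    · refine mul_nonneg (sub_nonneg.2 (hc1 x)) ?_
      rw [inner_sub_right, real_inner_self_eq_norm_sq]
      have := real_inner_le_norm (P x) (P y)
      rw [h] at this ⊢
      nlinarith [hnorm y]
  refine ⟨P, hnorm, fun x hx => by simp [P, hin x hx], fun x => ?_, fun x y => ?_⟩
  · rcases hdich x with h | h
    · left; simp [P, h]
    · exact Or.inr h
  · have h1 := hvar x y
    have h2 := hvar y x
    have h3 : inner ℝ (x - y) (P x - P y) = ‖P x - P y‖ ^ 2 + inner ℝ (x - P x) (P x - P y) +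
        inner ℝ (y - P y) (P y - P x) := by
      rw [← neg_sub (P x) (P y), inner_neg_right, ← real_inner_self_eq_norm_sq, ← inner_add_left,
        ← sub_eq_add_neg, ← inner_sub_left]
      congr 1
      abel
    have h4 := real_inner_le_norm (x - y) (P x - P y)
    rcases (norm_nonneg (P x - P y)).eq_or_lt with h | h
    · rw [← h]; exact norm_nonneg _
    · nlinarith

lemma IsMajorizedBy.norm_sub_le {f : ℂ → ℂ} {C D : ℕ → ℝ} {s L : ℝ} (hf : IsMajorizedBy f C)
    (hC : ∀ m, 0 ≤ C m) (hD : ∀ m : ℕ, (m : ℝ) + 2 ≤ D m) (hs : s < 1)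
    (hL : HasSum (fun m => C m * D m * s ^ (m + 1)) L) {x y : ℂ} (hx : ‖x‖ ≤ s) (hy : ‖y‖ ≤ s) :
    ‖(f x - x) - (f y - y)‖ ≤ L * ‖x - y‖ := by
  have hs0 : 0 ≤ s := (norm_nonneg x).trans hx
  have hx1 : x ∈ ball (0 : ℂ) 1 := by simpa using hx.trans_lt hs
  have hy1 : y ∈ ball (0 : ℂ) 1 := by simpa using hy.trans_lt hs
  have := hf x hx1 y hy1 y hy1 0 _ _ (fun m => ?_) (hL.mul_right ‖x - y‖)
  · simpa using this
  · have h1 := norm_pow_succ_sub_pow_succ_le hx hy (m + 1)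
    push_cast at h1
    simp only [Complex.ofReal_zero, sub_zero, one_mul, zero_mul, add_zero]
    calc _ ≤ C m * ((m + 1 + 1) * s ^ (m + 1) * ‖x - y‖) := mul_le_mul_of_nonneg_left h1 (hC m)
      _ ≤ C m * (D m * s ^ (m + 1) * ‖x - y‖) := by
        have := hC m
        have := hD m
        gcongr
        linarith
      _ = _ := by ring

/-- If `f - id` is contracting on a closed disk and the convex combination of two points of the
disk satisfies the power estimates, then the convex combination of their images is attained. -/
lemma IsMajorizedBy.convexComb_mem_image {f : ℂ → ℂ} {C D : ℕ → ℝ} {s L t : ℝ}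
    (hf : IsMajorizedBy f C) (hC : ∀ m, 0 ≤ C m) (hD : ∀ m : ℕ, (m : ℝ) + 2 ≤ D m)
    (hs0 : 0 < s) (hs : s < 1) (hL : HasSum (fun m => C m * D m * s ^ (m + 1)) L) (hL1 : L < 1)
    {z w : ℂ} (hz : ‖z‖ ≤ s) (hw : ‖w‖ ≤ s) (hzw : ‖(1 - t) * z + t * w‖ ≤ s)
    (hest : ∀ e : ℂ, ‖e‖ = s → ∀ m : ℕ,
      ‖e ^ (m + 2) - ((1 - t) * z ^ (m + 2) + t * w ^ (m + 2))‖ ≤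
        D m * s ^ (m + 1) * ‖e - ((1 - t) * z + t * w)‖) :
    (1 - t) * f z + t * f w ∈ f '' closedBall 0 s := by
  obtain ⟨P, hP1, hP2, hP3, hP4⟩ := exists_retraction_closedBall hs0
  have hL0 : 0 ≤ L := hL.nonneg fun m => by
    have := hC m
    have : 0 ≤ D m := (by positivity : (0 : ℝ) ≤ m + 2).trans (hD m)
    positivity
  set W := (1 - t) * f z + t * f w with hW
  set v := (1 - t) * z + t * w with hv
  have hmaps : MapsTo (fun x => P (W - (f x - x))) (closedBall 0 s) (closedBall 0 s) :=
    fun x _ => by simpa using hP1 _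
  have hcontr : ContractingWith ⟨L, hL0⟩ (hmaps.restrict _ _ _) := by
    refine ⟨by exact_mod_cast hL1, LipschitzWith.of_dist_le_mul fun x y => ?_⟩
    have hx : ‖(x : ℂ)‖ ≤ s := mem_closedBall_zero_iff.1 x.2
    have hy : ‖(y : ℂ)‖ ≤ s := mem_closedBall_zero_iff.1 y.2
    rw [Subtype.dist_eq, Subtype.dist_eq, dist_eq_norm, dist_eq_norm]
    refine (hP4 _ _).trans ?_
    have := hf.norm_sub_le hC hD hs hL hx hy
    rw [← norm_neg] at this
    convert! this using 2
    ring
  obtain ⟨e, he, hfix, -⟩ := hcontr.exists_fixedPoint' isClosed_closedBall.isComplete hmaps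
    (mem_closedBall_self hs0.le) (edist_ne_top _ _)
  have he' : ‖e‖ ≤ s := by simpa using he
  have hfix' : P (W - (f e - e)) = e := hfix
  set y := W - (f e - e) with hy
  have hye : y = e := by
    -- If `y` was moved or lies on the circle, then `‖e‖ = s` and `hest` gives `‖y - v‖ ≤ L ‖e -
    -- v‖`, while `P` fixes `v`, so `‖e - v‖ ≤ ‖y - v‖`. As `L < 1`, `y = v`, which is in the disk.
    rcases hP3 y with h | h
    · rw [← h, hfix']
    · rw [hfix'] at h
      have hball : ∀ x : ℂ, ‖x‖ ≤ s → x ∈ ball (0 : ℂ) 1 := fun x hx => by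
        simpa using hx.trans_lt hs
      have h1 : ‖y - v‖ ≤ L * ‖e - v‖ := by
        have := hf e (hball e he') z (hball z hz) w (hball w hw) t _ _ (fun m => ?_)
          (hL.mul_right ‖e - v‖)
        · rw [← norm_neg] at this
          convert! this using 2
          simp only [hy, hW, hv]
          ring
        · calc _ ≤ C m * (D m * s ^ (m + 1) * ‖e - v‖) :=
              mul_le_mul_of_nonneg_left (hest e h m) (hC m)
            _ = _ := by ring
      have h2 : ‖e - v‖ ≤ ‖y - v‖ := by
        have := hP4 y v
        rwa [hP2 v hzw, hfix'] at this
      have h3 : ‖y - v‖ = 0 := by nlinarith [norm_nonneg (y - v)]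
      have h4 : y = v := sub_eq_zero.1 (norm_eq_zero.1 h3)
      rw [← hfix', h4, hP2 v hzw]
  refine ⟨e, he, ?_⟩
  have : W - (f e - e) = e := hye
  linear_combination -this

lemma norm_add_lt_of_ne {x y : ℂ} {ρ : ℝ} (hx : ‖x‖ ≤ ρ) (hy : ‖y‖ ≤ ρ) (hxy : x ≠ y) :
    ‖x + y‖ < 2 * ρ := by
  have h := parallelogram_law_with_norm ℝ x y
  have h1 : 0 < ‖x - y‖ := norm_pos_iff.2 (sub_ne_zero.2 hxy)
  have hρ : 0 ≤ ρ := (norm_nonneg x).trans hx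
  nlinarith [norm_nonneg (x + y), norm_nonneg x, norm_nonneg y]

/-- Univalence up to and including the radius at which the majorant equals `1`. -/
lemma IsMajorizedBy.injOn {f : ℂ → ℂ} {C D : ℕ → ℝ} {ρ : ℝ} (hf : IsMajorizedBy f C)
    (hC : ∀ m, 0 < C m) (hD : ∀ m : ℕ, (m : ℝ) + 2 ≤ D m) (hρ : ρ < 1)
    (hL : HasSum (fun m => C m * D m * ρ ^ (m + 1)) 1) : InjOn f (closedBall 0 ρ) := by
  intro x hx y hy hxy
  by_contra hne
  have hx' : ‖x‖ ≤ ρ := by simpa using hx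
  have hy' : ‖y‖ ≤ ρ := by simpa using hy
  have hρ0 : 0 ≤ ρ := (norm_nonneg x).trans hx'
  have hx1 : x ∈ ball (0 : ℂ) 1 := by simpa using hx'.trans_lt hρ
  have hy1 : y ∈ ball (0 : ℂ) 1 := by simpa using hy'.trans_lt hρ
  have hδ : 0 < ‖x - y‖ := norm_pos_iff.2 (sub_ne_zero.2 hne)
  -- At this radius the Lipschitz constant is exactly `1`. Strictness comes from the quadratic term,
  -- where `‖x + y‖ < 2 ρ` for distinct points; `η` is the amount saved.
  set η := C 0 * (2 * ρ - ‖x + y‖) * ‖x - y‖ with hη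
  have hηpos : 0 < η :=
    mul_pos (mul_pos (hC 0) (sub_pos.2 (norm_add_lt_of_ne hx' hy' hne))) hδ
  have hS := (hL.mul_right ‖x - y‖).sub (hasSum_ite_eq (0 : ℕ) η)
  have := hf x hx1 y hy1 y hy1 0 _ _ (fun m => ?_) hS
  · simp only [Complex.ofReal_zero, sub_zero, one_mul, zero_mul, add_zero, hxy] at this
    rw [sub_sub_sub_cancel_left, norm_sub_rev] at this
    linarith
  · simp only [Complex.ofReal_zero, sub_zero, one_mul, zero_mul, add_zero]
    rcases m with _ | m
    · have e : x ^ (0 + 2) - y ^ (0 + 2) = (x + y) * (x - y) := by ring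
      have hD0 : 2 ≤ D 0 := by simpa using hD 0
      rw [e, norm_mul, if_pos rfl, hη]
      have := mul_nonneg (mul_nonneg (mul_nonneg (hC 0).le (sub_nonneg.2 hD0)) hρ0) hδ.le
      simp only [zero_add, pow_one]
      nlinarith
    · have h1 := norm_pow_succ_sub_pow_succ_le hx' hy' (m + 1 + 1)
      rw [if_neg (Nat.succ_ne_zero m), sub_zero]
      calc _ ≤ C (m + 1) * (((m + 1 + 1 : ℕ) + 1) * ρ ^ (m + 1 + 1) * ‖x - y‖) :=
            mul_le_mul_of_nonneg_left h1 (hC _).le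
        _ ≤ C (m + 1) * (D (m + 1) * ρ ^ (m + 1 + 1) * ‖x - y‖) := by
          have := (hC (m + 1)).le
          have := hD (m + 1)
          gcongr
          push_cast at this ⊢
          linarith
        _ = _ := by ring

lemma exists_hasSum_lt_of_lt {c : ℕ → ℝ} {s ρ S : ℝ} (hc : ∀ m, 0 < c m) (hs : 0 ≤ s)
    (hsρ : s < ρ) (hS : HasSum (fun m => c m * ρ ^ (m + 1)) S) :
    ∃ L < S, HasSum (fun m => c m * s ^ (m + 1)) L := by
  have hle : ∀ m, c m * s ^ (m + 1) ≤ c m * ρ ^ (m + 1) := fun m => by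
    have := (hc m).le
    gcongr
  have hsum : Summable fun m => c m * s ^ (m + 1) := by
    refine Summable.of_nonneg_of_le (fun m => ?_) hle hS.summable
    have := (hc m).le
    positivity
  refine ⟨_, hasSum_lt (i := 0) hle ?_ hsum.hasSum hS, hsum.hasSum⟩
  simpa using mul_lt_mul_of_pos_left hsρ (hc 0)

/-- Reduces closed disks to open ones, including the extremal radius, where no strict contraction is
available. -/
lemma image_closedBall_eq_closure {f : ℂ → ℂ} (hf : ContinuousOn f (ball 0 1)) {r : ℝ}
    (hr0 : 0 < r) (hr : r < 1) : f '' closedBall 0 r = closure (f '' ball 0 r) := by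
  have hc : ContinuousOn f (closedBall 0 r) := hf.mono (closedBall_subset_ball hr)
  apply subset_antisymm
  · rw [← closure_ball (0 : ℂ) hr0.ne'] at hc ⊢
    exact hc.image_closure
  · exact closure_minimal (image_mono ball_subset_closedBall)
      ((isCompact_closedBall (0 : ℂ) r).image_of_continuousOn hc).isClosed

lemma StarConvex.closure_zero {A : Set ℂ} (hA : StarConvex ℝ 0 A) :
    StarConvex ℝ 0 (closure A) := by
  rw [starConvex_zero_iff] at hA ⊢
  intro x hx a ha0 ha1
  exact map_mem_closure (continuous_const_smul a) hx fun y hy => hA hy ha0 ha1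

/-! ### Starlikeness and convexity from coefficient series. -/

/-- `∑ n |cₙ| ρ ^ (n - 1) = 1` gives starlikeness in `|z| ≤ ρ`. -/
lemma IsMajorizedBy.isStarlikeInDisk {f : ℂ → ℂ} {C : ℕ → ℝ} {ρ : ℝ} (hf : IsMajorizedBy f C)
    (hcont : ContinuousOn f (ball 0 1)) (hf0 : f 0 = 0) (hC : ∀ m, 0 < C m)
    (hρ : ρ < 1) (hL : HasSum (fun m : ℕ => C m * (m + 2) * ρ ^ (m + 1)) 1) :
    IsStarlikeInDisk f ρ := by
  refine ⟨hf.injOn hC (fun m => le_rfl) hρ hL, fun r hr0 hr => ?_⟩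
  have hball : StarConvex ℝ 0 (f '' ball 0 r) := by
    rw [starConvex_zero_iff]
    rintro _ ⟨z, hz, rfl⟩ t ht0 ht1
    -- Passing to a radius `s < r ≤ ρ` brings the series strictly below `1`.
    obtain ⟨s, hs1, hs2⟩ := exists_between (show ‖z‖ < r by simpa using hz)
    have hs0 : 0 < s := (norm_nonneg z).trans_lt hs1
    obtain ⟨L, hL1, hLs⟩ := exists_hasSum_lt_of_lt (c := fun m => C m * (m + 2))
      (fun m => mul_pos (hC m) (by positivity)) hs0.le (hs2.trans_le hr) hL
    have := hf.convexComb_mem_image (t := t) (D := fun m => (m : ℝ) + 2) (z := 0) (w := z)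
      (fun m => (hC m).le) (fun m => le_rfl) hs0 ((hs2.trans_le hr).trans hρ) hLs hL1
      (by simpa using hs0.le) hs1.le ?_ fun e he m => ?_
    · rw [hf0, mul_zero, zero_add] at this
      rw [Complex.real_smul]
      exact image_mono (closedBall_subset_ball hs2) this
    · rw [mul_zero, zero_add, norm_mul, Complex.norm_real, Real.norm_eq_abs, abs_of_nonneg ht0]
      exact (mul_le_of_le_one_left (norm_nonneg z) ht1).trans hs1.le
    · have := norm_pow_sub_mul_pow_le hs0 he hs1.le ht0 ht1 (m + 1)
      refine this.trans_eq ?_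
      push_cast
      ring
  refine ⟨hball, ?_⟩
  rw [image_closedBall_eq_closure hcont hr0 (hr.trans_lt hρ)]
  exact hball.closure_zero

/-- `∑ n ^ 2 |cₙ| ρ ^ (n - 1) = 1` gives convexity in `|z| ≤ ρ`. -/
lemma IsMajorizedBy.isConvexInDisk {f : ℂ → ℂ} {C : ℕ → ℝ} {ρ : ℝ} (hf : IsMajorizedBy f C)
    (hcont : ContinuousOn f (ball 0 1)) (hC : ∀ m, 0 < C m)
    (hρ : ρ < 1) (hL : HasSum (fun m : ℕ => C m * (m + 2) ^ 2 * ρ ^ (m + 1)) 1) :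
    IsConvexInDisk f ρ := by
  have hD : ∀ m : ℕ, (m : ℝ) + 2 ≤ (m + 2) ^ 2 := fun m => by
    have : (0 : ℝ) ≤ m := by positivity
    nlinarith
  refine ⟨hf.injOn (D := fun m => ((m : ℝ) + 2) ^ 2) hC hD hρ hL, fun r hr0 hr => ?_⟩
  have hball : Convex ℝ (f '' ball 0 r) := by
    rintro _ ⟨z, hz, rfl⟩ _ ⟨w, hw, rfl⟩ a t ha0 ht0 hat
    obtain rfl : a = 1 - t := by linarith
    have ht1 : t ≤ 1 := by linarith
    obtain ⟨s, hs1, hs2⟩ := exists_between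
      (show max ‖z‖ ‖w‖ < r from max_lt (by simpa using hz) (by simpa using hw))
    have hzs : ‖z‖ ≤ s := (le_max_left _ _).trans hs1.le
    have hws : ‖w‖ ≤ s := (le_max_right _ _).trans hs1.le
    have hs0 : 0 < s := ((norm_nonneg z).trans (le_max_left _ _)).trans_lt hs1
    obtain ⟨L, hL1, hLs⟩ := exists_hasSum_lt_of_lt (c := fun m => C m * (m + 2) ^ 2)
      (fun m => mul_pos (hC m) (by positivity)) hs0.le (hs2.trans_le hr) hL
    have := hf.convexComb_mem_image (t := t) (D := fun m => ((m : ℝ) + 2) ^ 2) (z := z) (w := w)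
      (fun m => (hC m).le) hD hs0 ((hs2.trans_le hr).trans hρ) hLs hL1 hzs hws ?_ fun e he m => ?_
    · rw [Complex.real_smul, Complex.real_smul]
      push_cast
      exact image_mono (closedBall_subset_ball hs2) this
    · have := convex_closedBall (0 : ℂ) s (mem_closedBall_zero_iff.2 hzs)
        (mem_closedBall_zero_iff.2 hws) ha0 ht0 hat
      simpa using this
    · have := norm_pow_sub_convexComb_pow_le hs0 he hzs hws ht0 ht1 (m + 1)
      refine this.trans_eq ?_
      push_cast
      ring
  refine ⟨hball, ?_⟩
  rw [image_closedBall_eq_closure hcont hr0 (hr.trans_lt hρ)]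
  exact hball.closure

/-! ### Hypergeometric series and the root equations. -/

lemma eval_ascPochhammer_succ_left_mul {b : ℝ} (n : ℕ) :
    b * (ascPochhammer ℝ n).eval (1 + b) = (ascPochhammer ℝ n).eval b * (b + n) := by
  have h1 := ascPochhammer_succ_eval n b
  have h2 : (ascPochhammer ℝ (n + 1)).eval b = b * (ascPochhammer ℝ n).eval (1 + b) := by
    rw [ascPochhammer_succ_left]
    simp [add_comm]
  rw [← h2, h1]

/-- `(1)ₘ` cancels `m!`, and with `b = 1 / α` the quotient `(b)ₘ / (1 + b)ₘ` telescopes to `b / (b +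
m)`. -/
lemma hypergeometric_one_eq_tsum {α : ℝ} (hα : 0 < α) (r : ℝ) :
    ₂F₁ (1 : ℝ) (1 / α) (1 + 1 / α) r = ∑' m : ℕ, 1 / (1 + α * m) * r ^ m := by
  rw [ordinaryHypergeometric_eq_tsum]
  refine tsum_congr fun m => ?_
  have hb : 0 < 1 / α := by positivity
  have h1 := eval_ascPochhammer_succ_left_mul (b := 1 / α) m
  have h2 : (ascPochhammer ℝ m).eval (1 + 1 / α) ≠ 0 := (ascPochhammer_pos m _ (by positivity)).ne'
  have h3 : (m.factorial : ℝ) ≠ 0 := by positivity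
  have h4 : 1 + α * m ≠ 0 := by positivity
  have h5 : (ascPochhammer ℝ m).eval (1 / α) * (1 + α * m) =
      (ascPochhammer ℝ m).eval (1 + 1 / α) := by
    have : α * (1 / α) = 1 := by field_simp
    linear_combination (-α) * h1 + ((ascPochhammer ℝ m).eval (1 + 1 / α) -
      (ascPochhammer ℝ m).eval (1 / α)) * this
  rw [ascPochhammer_eval_one, smul_eq_mul, ← h5]
  rw [← h5] at h2
  have h6 := left_ne_zero_of_mul h2
  field_simp

lemma summable_add_two_mul_pow {r : ℝ} (h0 : 0 ≤ r) (h1 : r < 1) :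
    Summable fun m : ℕ => ((m : ℝ) + 2) * r ^ (m + 1) := by
  have hr : ‖r‖ < 1 := by rwa [Real.norm_eq_abs, abs_of_nonneg h0]
  have a := (summable_pow_mul_geometric_of_norm_lt_one 1 hr).mul_right r
  have b := (summable_geometric_of_norm_lt_one hr).mul_right (2 * r)
  refine (a.add b).congr fun m => ?_
  ring

lemma summable_mul_pow_succ {E : ℕ → ℝ} (hE0 : ∀ m, 0 ≤ E m) (hE : ∀ m : ℕ, E m ≤ m + 2) {r : ℝ}
    (h0 : 0 ≤ r) (h1 : r < 1) : Summable fun m : ℕ => E m * r ^ (m + 1) := by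
  refine Summable.of_nonneg_of_le (fun m => ?_) (fun m => ?_) (summable_add_two_mul_pow h0 h1)
  · have := hE0 m
    positivity
  · have := hE m
    gcongr

/-- The upper bound on `E` gives convergence on `[0, 1)`; the lower bound lets the divergent
harmonic series push the sum past any `c` near `1`, and the intermediate value theorem finishes. -/
lemma exists_hasSum_mul_pow_succ_eq {E : ℕ → ℝ} (hE0 : ∀ m : ℕ, 1 / ((m : ℝ) + 1) ≤ E m)
    (hE : ∀ m : ℕ, E m ≤ m + 2) {c : ℝ} (hc : 0 < c) :
    ∃ r ∈ Ioo (0 : ℝ) 1, HasSum (fun m => E m * r ^ (m + 1)) c := by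
  have hEn : ∀ m, 0 ≤ E m := fun m => (by positivity : (0 : ℝ) ≤ 1 / ((m : ℝ) + 1)).trans (hE0 m)
  obtain ⟨N, hN⟩ := (Real.tendsto_sum_range_one_div_nat_succ_atTop.eventually_gt_atTop c).exists
  obtain ⟨b, hb, hb1⟩ : ∃ b : ℝ, c < ∑ i ∈ Finset.range N, 1 / ((i : ℝ) + 1) * b ^ (i + 1) ∧
      b ∈ Ioo (0 : ℝ) 1 := by
    have hcont : Continuous fun b : ℝ => ∑ i ∈ Finset.range N, 1 / ((i : ℝ) + 1) * b ^ (i + 1) := by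
      fun_prop
    have h := (hcont.tendsto 1).mono_left (nhdsWithin_le_nhds (s := Iio 1))
    simp only [one_pow, mul_one] at h
    exact ((h.eventually (lt_mem_nhds hN)).and (Ioo_mem_nhdsLT (zero_lt_one' ℝ))).exists
  have hcont : ContinuousOn (fun r : ℝ => ∑' m, E m * r ^ (m + 1)) (Icc 0 b) := by
    refine continuousOn_tsum (fun m => by fun_prop) (summable_mul_pow_succ hEn hE hb1.1.le hb1.2)
      fun m r hr => ?_
    have := hEn m
    have := hr.1
    rw [Real.norm_eq_abs, abs_of_nonneg (by positivity)]
    gcongr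
    exact hr.2
  have hbig : c < ∑' m, E m * b ^ (m + 1) := by
    refine hb.trans_le ((Finset.sum_le_sum fun i _ => ?_).trans
      ((summable_mul_pow_succ hEn hE hb1.1.le hb1.2).sum_le_tsum (Finset.range N) fun i _ => ?_))
    · have := hE0 i
      have := hb1.1.le
      gcongr
    · have := hEn i
      have := hb1.1.le
      positivity
  obtain ⟨r, hr, hrc⟩ := intermediate_value_Ioo hb1.1.le hcont ⟨by simpa using hc, hbig⟩
  have hr1 := hr.2.trans hb1.2
  exact ⟨r, ⟨hr.1, hr1⟩, hrc ▸ (summable_mul_pow_succ hEn hE hr.1.le hr1).hasSum⟩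

/-- A strictly increasing power series minus a positive constant has a least zero in `(0, 1)`. -/
lemma exists_isLeast_root {E : ℕ → ℝ} (hE0 : ∀ m : ℕ, 1 / ((m : ℝ) + 1) ≤ E m)
    (hE : ∀ m : ℕ, E m ≤ m + 2) {a c : ℝ} (ha : a ≠ 0) (hc : 0 < c) {F : ℝ → ℝ}
    (hF : ∀ r ∈ Ioo (0 : ℝ) 1, F r = a * (∑' m, E m * r ^ (m + 1) - c)) :
    ∃ r, IsLeast {r : ℝ | r ∈ Ioo 0 1 ∧ F r = 0} r ∧ r < 1 ∧
      HasSum (fun m => E m * r ^ (m + 1)) c := by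
  have hEp : ∀ m, 0 < E m := fun m =>
    (by positivity : (0 : ℝ) < 1 / ((m : ℝ) + 1)).trans_le (hE0 m)
  obtain ⟨r, hr, hrc⟩ := exists_hasSum_mul_pow_succ_eq hE0 hE hc
  refine ⟨r, ⟨⟨hr, by rw [hF r hr, hrc.tsum_eq, sub_self, mul_zero]⟩, fun s hs => ?_⟩, hr.2, hrc⟩
  by_contra! hlt
  obtain ⟨L, hL1, hL⟩ := exists_hasSum_lt_of_lt hEp hs.1.1.le hlt hrc
  have h := hs.2
  rw [hF s hs.1, hL.tsum_eq] at h
  exact (mul_ne_zero ha (sub_ne_zero.2 hL1.ne)) h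

lemma starlikeFun_eq {α M r : ℝ} (hα : 0 < α) :
    starlikeFun α M r =
      α * (∑' m : ℕ, 1 / (1 + α * m) * r ^ (m + 1) - 1 / (2 * (M - α + 1))) := by
  rw [starlikeFun, hypergeometric_one_eq_tsum hα, mul_assoc, ← tsum_mul_left]
  simp only [pow_succ, mul_sub, mul_comm r, mul_assoc, mul_one_div]

lemma convexFun_eq {α M r : ℝ} (hα : 0 < α) (hr : r ∈ Ioo (0 : ℝ) 1) :
    convexFun α M r =
      α * (∑' m : ℕ, (m + 2) / (1 + α * m) * r ^ (m + 1) - 1 / (2 * (M - α + 1))) := by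
  have h0 : ∀ m : ℕ, 0 < 1 + α * m := fun m => by positivity
  have hs : Summable fun m : ℕ => 1 / (1 + α * m) * r ^ (m + 1) := by
    refine summable_mul_pow_succ (fun m => by have := h0 m; positivity) (fun m => ?_) hr.1.le hr.2
    rw [div_le_iff₀ (h0 m)]
    have : 0 ≤ α * m := by positivity
    nlinarith [Nat.cast_nonneg (α := ℝ) m]
  have hg : HasSum (fun m : ℕ => r * r ^ m) (r * (1 - r)⁻¹) :=
    (hasSum_geometric_of_lt_one hr.1.le hr.2).mul_left r
  have h := ((hg.add (hs.hasSum.mul_left (2 * α - 1))).mul_left α⁻¹).tsum_eq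
  -- Partial fractions: `α (m + 2) = (1 + α m) + (2 α - 1)`.
  have e : ∀ m : ℕ, α⁻¹ * (r * r ^ m + (2 * α - 1) * (1 / (1 + α * m) * r ^ (m + 1))) =
      (m + 2) / (1 + α * m) * r ^ (m + 1) := fun m => by
    have := (h0 m).ne'
    field_simp
    ring
  simp only [e] at h
  have hst := starlikeFun_eq (M := M) (r := r) hα
  rw [starlikeFun] at hst
  rw [h, convexFun]
  have hα' := hα.ne'
  have h1 : α * r * ₂F₁ (1 : ℝ) (1 / α) (1 + 1 / α) r =
      α * ∑' m : ℕ, 1 / (1 + α * m) * r ^ (m + 1) := by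
    rw [mul_sub, mul_one_div] at hst
    linarith
  have h2 : r * ₂F₁ (1 : ℝ) (1 / α) (1 + 1 / α) r = ∑' m : ℕ, 1 / (1 + α * m) * r ^ (m + 1) :=
    mul_left_cancel₀ hα' (by rw [← h1, mul_assoc])
  rw [mul_assoc, h2, mul_sub, ← mul_assoc, mul_inv_cancel₀ hα', one_mul, mul_one_div, div_eq_mul_inv]

theorem mainTheorem4 (α M : ℝ) (hα : 0 < α) (hα' : α ≤ 1) (hM : 0 < M) :
    (∃ rs : ℝ, IsLeast {r : ℝ | r ∈ Set.Ioo 0 1 ∧ starlikeFun α M r = 0} rs ∧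
      ∀ f ∈ PHZero α M, IsStarlikeInDisk f rs) ∧
    (∃ rc : ℝ, IsLeast {r : ℝ | r ∈ Set.Ioo 0 1 ∧ convexFun α M r = 0} rc ∧
      ∀ f ∈ PHZero α M, IsConvexInDisk f rc) := by
  have hk : 0 < M - α + 1 := by linarith
  have hc : 0 < 1 / (2 * (M - α + 1)) := by positivity
  have hden : ∀ m : ℕ, 0 < 1 + α * m := fun m => by positivity
  have hle : ∀ m : ℕ, 1 + α * m ≤ m + 1 := fun m => by
    nlinarith [Nat.cast_nonneg (α := ℝ) m]
  have hge : ∀ m : ℕ, 1 ≤ 1 + α * m := fun m => by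
    have : 0 ≤ α * m := by positivity
    linarith
  have hpos := coeffBound_pos hα hα' hM
  constructor
  · obtain ⟨r, hr, hr1, hsum⟩ := exists_isLeast_root (E := fun m : ℕ => 1 / (1 + α * m))
      (fun m => one_div_le_one_div_of_le (hden m) (hle m))
      (fun m => ((div_le_one (hden m)).2 (hge m)).trans
        (by linarith [Nat.cast_nonneg (α := ℝ) m])) hα.ne' hc fun r _ => starlikeFun_eq hα
    refine ⟨r, hr, fun f hf => (isMajorizedBy_of_mem_PHZero hα hf).isStarlikeInDisk
      (continuousOn_of_mem_PHZero hf) (map_zero_of_mem_PHZero hf) hpos hr1 ?_⟩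
    -- The factor `m + 2` cancels the one in the denominator of `coeffBound`.
    convert! hsum.mul_left (2 * (M - α + 1)) using 1
    · ext m
      have := (hden m).ne'
      rw [coeffBound]
      field_simp
    · field_simp
  · obtain ⟨r, hr, hr1, hsum⟩ := exists_isLeast_root (E := fun m : ℕ => (m + 2) / (1 + α * m))
      (fun m => by
        have := hle m
        have := hden m
        gcongr
        linarith [Nat.cast_nonneg (α := ℝ) m])
      (fun m => div_le_self (by positivity) (hge m)) hα.ne' hc fun r hr => convexFun_eq hα hr
    refine ⟨r, hr, fun f hf => (isMajorizedBy_of_mem_PHZero hα hf).isConvexInDisk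
      (continuousOn_of_mem_PHZero hf) hpos hr1 ?_⟩
    convert! hsum.mul_left (2 * (M - α + 1)) using 1
    · ext m
      have := (hden m).ne'
      rw [coeffBound]
      field_simp
    · field_simp
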